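/- Let $d\in\{2,3\}$, $K,C,B_0>0$, $A,B,a,b,c,q\in\mathbb R$, with $A<0$ if $d=2$, and $B>0$, $A<B^2/(27C)$ if $d=3$. Put $s_+=\sqrt{-2A/C}$ if $d=2$, $s_+=\frac{B+\sqrt{B^2-24AC}}{4C}$ if $d=3$, and $b_2=0$, $b_3=|B|/\sqrt6$. On the uniform periodic grid with $J\ge1$ cells per direction and mesh size $h=L/J$ ($L>0$), let $D_k^{\pm},D_k^c$ be the forward/backward and central differences, $\Delta_h=\sum_kD_k^+D_k^-$, $(D_h^2u)^{kl}=D_k^cD_l^cu$, $\nabla_h\cdot\nabla_h\cdot\Phi=\sum_{k,l}D_k^-D_l^-\Phi^{kl}$, $\langle U,V\rangle_h=h^d\sum_xU(x)V(x)$ (summed entrywise for matrix-valued functions), $\|U\|_h^2=\langle U,U\rangle_h$, and $\|\Phi\|_\infty=\max_x|\Phi(x)|_F$ with the Frobenius norm $|\cdot|_F$. For grid functions $Q$ (matrix-valued) and $u$ (scalar) put $M=Q/s_++I/d$, $$T_1(u)=\tfrac{2B_0q^2}{s_+}\big(u\,D_h^2u-\tfrac{\operatorname{tr}(u\,D_h^2u)}{d}I\big),\qquad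 \tilde A_u(x)=A+\tfrac{2B_0q^4}{s_+^2}u(x)^2,$$ $$H(Q,u)=AQ-B\big(Q^2-\tfrac{\operatorname{tr}Q^2}{d}I\big)+C\operatorname{tr}(Q^2)Q+T_1(u)+\tfrac{2B_0q^4}{s_+^2}u^2Q,$$ $$\mu(Q,u)=au+bu^2+cu^3+2B_0q^2\,M:D_h^2u+2B_0q^2\,\nabla_h\cdot\nabla_h\cdot(Mu)+2B_0q^4|M|_F^2u,$$ $$E_{1h}(Q,u)=2B_0q^2\langle D_h^2u,Mu\rangle_h+B_0q^4\|Mu\|_h^2+\langle f_{bn}(Q)+f_s(u),1\rangle_h,$$ where $f_{bn}(Q)=\frac A2\operatorname{tr}Q^2-\frac B3\operatorname{tr}Q^3+\frac C4(\operatorname{tr}Q^2)^2$ (without the $B$-term if $d=2$) and $f_s(u)=\frac a2u^2+\frac b3u^3+\frac c4u^4$. Let $\tau,\kappa_1,\kappa_2>0$, $\eta_0\in[0,1]$, $\phi_1(z)=(e^z-1)/z$, and let $(Q_h^n,u_h^n,s^n)_{n\ge0}$ be generated by the first-order relaxed GSAV exponential integrator (ETD1) scheme: $Q_h^0$ is symmetric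 and traceless, $s^0=E_{1h}(Q_h^0,u_h^0)$, and with $E_{1h}^n=E_{1h}(Q_h^n,u_h^n)$, $H^n=H(Q_h^n,u_h^n)$, $\mu^n=\mu(Q_h^n,u_h^n)$, $g^n=e^{s^n}/e^{E_{1h}^n}$, $\mathcal L^n=-K\Delta_h+g^n\kappa_1$, $\mathcal D^n=2B_0\Delta_h^2+g^n\kappa_2$, $$Q_h^{n+1}=e^{-\tau\mathcal L^n}Q_h^n+\tau\phi_1(-\tau\mathcal L^n)\big(g^n\kappa_1Q_h^n-g^nH^n\big),\qquad u_h^{n+1}=e^{-\tau\mathcal D^n}u_h^n+\tau\phi_1(-\tau\mathcal D^n)\big(g^n\kappa_2u_h^n-g^n\mu^n\big),$$ $$\tilde s^{n+1}=s^n+g^n\big(\langle H^n,Q_h^{n+1}-Q_h^n\rangle_h+\langle\mu^n,u_h^{n+1}-u_h^n\rangle_h\big),\qquad s^{n+1}=\xi^{n+1}\tilde s^{n+1}+(1-\xi^{n+1})E_{1h}^{n+1}$$ for some $\xi^{n+1}\in[0,1]$ such that $s^{n+1}-\tilde s^{n+1}\le\eta_0\tau\mathcal R^{n+1}$. Here $\mathcal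 R^{n+1}=\frac1\tau\big(\langle\mathcal Q_1(\tau\mathcal L^n)\delta Q,\delta Q\rangle_h+\langle\mathcal Q_1(\tau\mathcal D^n)\delta u,\delta u\rangle_h\big)$ with $\mathcal Q_1(z)=\frac z{e^z-1}+\frac z2$, $\delta Q=Q_h^{n+1}-Q_h^n$, $\delta u=u_h^{n+1}-u_h^n$. For $S\in\mathbb R$ let $f_{d,S}(\xi)=-A\xi+b_d\xi^2-C\xi^3+S$, and for $\eta>0$ and a grid function $u$ let $$\kappa_0(u,\eta)=\max\Big\{\max_x\tilde A_u(x)+C\eta^2,\ \max_{\xi\in[0,\eta]}(A-2b_d\xi+3C\xi^2)\Big\}.$$ Then: (i) For every $S\in\mathbb R$ there is $\eta_{\min}>0$ such that $f_{d,S}(\eta)\le0$ for all $\eta\ge\eta_{\min}$. (ii) Let $M\in\mathbb N\cup\{\infty\}$ and let $\eta>0$ be so large that $f_{d,S^n}(\eta)\le0$ with $S^n=\|T_1(u_h^n)\|_\infty$ for all $n<M$. Let $G_*>0$ be a lower bound of $g^n$ for $n<M$, and suppose $\kappa_1\ge\frac1{G_*}\kappa_0(u_h^n,\eta)$ for all $n<M$.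 If $\|Q_h^0\|_\infty\le\eta$, then $\|Q_h^n\|_\infty\le\eta$ for all $n\le M$ (all $n\ge0$ if $M=\infty$). -/

import Mathlib

open scoped Matrix

noncomputable section

namespace SmA

/-! ### Parameters -/

/-- Physical parameters of the modified Landau-de Gennes smectic-A energy. -/
structure Params where
  /-- elastic constant -/
  K : ℝ
  /-- nematic bulk constants -/
  A : ℝ
  B : ℝ
  C : ℝ
  /-- smectic bulk constants -/
  a : ℝ
  b : ℝ
  c : ℝ
  /-- nematic-smectic coupling strength -/
  B₀ : ℝ
  /-- wave number of the layers -/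
  q : ℝ

/-- Numerical parameters: edge length of the periodic box, time step, the two stabilization
parameters and the relaxation parameter. -/
structure NumParams where
  len : ℝ
  τ : ℝ
  κ₁ : ℝ
  κ₂ : ℝ
  η₀ : ℝ

/-- The equilibrium order parameter `s₊` (in the regime where the two orders are coupled). -/
def Params.sPlus (d : ℕ) (P : Params) : ℝ :=
  if d = 3 then (P.B + Real.sqrt (P.B ^ 2 - 24 * P.A * P.C)) / (4 * P.C)
  else Real.sqrt (-2 * P.A / P.C)

/-! ### Grid functions and difference operators -/

section Grid

variable {d J : ℕ}

/-- Mesh points of the uniform grid with `J` cells per direction on a `d`-dimensional box, with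
opposite faces identified: the index of a node is taken modulo `J` in every direction. -/
abbrev Grid (d J : ℕ) := Fin d → ZMod J

/-- Periodic scalar grid functions. -/
abbrev GridFun (d J : ℕ) := Grid d J → ℝ

/-- Periodic matrix-valued grid functions. -/
abbrev GridTensor (d J : ℕ) := Grid d J → Matrix (Fin d) (Fin d) ℝ

/-- The unit index vector in direction `k`. -/
def unitVec (k : Fin d) : Grid d J := Pi.single k 1

/-- Forward difference `D_k^+`. -/
def fwdD (h : ℝ) (k : Fin d) : GridFun d J →ₗ[ℝ] GridFun d J where
  toFun U := fun x => (U (x + unitVec k) - U x) / h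
  map_add' U V := by ext x; simp only [Pi.add_apply]; ring
  map_smul' r U := by
    ext x; simp only [Pi.smul_apply, smul_eq_mul, RingHom.id_apply]; ring

/-- Backward difference `D_k^-`. -/
def bwdD (h : ℝ) (k : Fin d) : GridFun d J →ₗ[ℝ] GridFun d J where
  toFun U := fun x => (U x - U (x - unitVec k)) / h
  map_add' U V := by ext x; simp only [Pi.add_apply]; ring
  map_smul' r U := by
    ext x; simp only [Pi.smul_apply, smul_eq_mul, RingHom.id_apply]; ring

/-- Central difference `D_k^c`. -/
def cenD (h : ℝ) (k : Fin d) : GridFun d J →ₗ[ℝ] GridFun d J where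
  toFun U := fun x => (U (x + unitVec k) - U (x - unitVec k)) / (2 * h)
  map_add' U V := by ext x; simp only [Pi.add_apply]; ring
  map_smul' r U := by
    ext x; simp only [Pi.smul_apply, smul_eq_mul, RingHom.id_apply]; ring

/-- Discrete Laplacian `Δ_h = ∑_k D_k^+ D_k^-`. -/
def lapl (h : ℝ) : GridFun d J →ₗ[ℝ] GridFun d J :=
  ∑ k : Fin d, fwdD h k ∘ₗ bwdD h k

/-- Discrete Hessian `(D_h² U)^{kl} = D_k^c D_l^c U`. -/
def hess (h : ℝ) (U : GridFun d J) : GridTensor d J :=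
  fun x => Matrix.of fun k l => cenD h k (cenD h l U) x

/-- Discrete double divergence `∇_h · (∇_h · Φ) = ∑_{k,l} D_k^- D_l^- Φ^{kl}`. -/
def divDiv (h : ℝ) (Φ : GridTensor d J) : GridFun d J :=
  ∑ k : Fin d, ∑ l : Fin d, bwdD h k (bwdD h l fun x => Φ x k l)

/-- Frobenius norm of a matrix. -/
def frob (M : Matrix (Fin d) (Fin d) ℝ) : ℝ := Real.sqrt (∑ i, ∑ j, M i j ^ 2)

variable [NeZero J]

/-- Maximum norm `max_x |Φ(x)|_F` of a matrix-valued grid function. -/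
def tensorSup (Φ : GridTensor d J) : ℝ := ⨆ x, frob (Φ x)

/-- Discrete inner product of scalar grid functions (each node of the periodic grid is counted
once). -/
def ip (h : ℝ) (U V : GridFun d J) : ℝ := h ^ d * ∑ x, U x * V x

/-- Discrete Frobenius inner product of matrix-valued grid functions. -/
def ipT (h : ℝ) (Φ Ψ : GridTensor d J) : ℝ :=
  ∑ i, ∑ j, ip h (fun x => Φ x i j) (fun x => Ψ x i j)

/-- An operator on scalar grid functions acts entrywise on matrix-valued ones. -/
def entrywise (T : GridFun d J →L[ℝ] GridFun d J) (Φ : GridTensor d J) : GridTensor d J :=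
  fun x => Matrix.of fun i j => T (fun y => Φ y i j) x

end Grid

/-! ### Operator functions -/

/-- `φ₁(T)` for `φ₁(z) = (e^z - 1) / z = ∑ₖ z^k / (k+1)!`. -/
def phi1 {𝔸 : Type*} [NormedRing 𝔸] [NormedAlgebra ℝ 𝔸] (T : 𝔸) : 𝔸 :=
  ∑' k : ℕ, (((k + 1).factorial : ℝ)⁻¹) • T ^ k

/-- `𝒬(T)` for `𝒬(z) = z / (e^z - 1)`, the inverse of `φ₁(z)`. -/
def opQ {𝔸 : Type*} [NormedRing 𝔸] [NormedAlgebra ℝ 𝔸] (T : 𝔸) : 𝔸 :=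
  Ring.inverse (phi1 T)

/-! ### Discrete energy and its variations -/

section Model

variable {d J : ℕ} (P : Params)

/-- Nematic bulk density. -/
def fbn (M : Matrix (Fin d) (Fin d) ℝ) : ℝ :=
  P.A / 2 * (M ^ 2).trace - (if d = 3 then P.B / 3 * (M ^ 3).trace else 0)
    + P.C / 4 * (M ^ 2).trace ^ 2

/-- Smectic bulk density. -/
def fs (v : ℝ) : ℝ := P.a / 2 * v ^ 2 + P.b / 3 * v ^ 3 + P.c / 4 * v ^ 4

/-- The tensor `M = Q / s₊ + I / d`. -/
def tensorM (Q : GridTensor d J) : GridTensor d J :=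
  fun x => (P.sPlus d)⁻¹ • Q x + ((d : ℝ)⁻¹) • (1 : Matrix (Fin d) (Fin d) ℝ)

/-- Source term `T₁ = (2 B₀ q² / s₊) (u D_h² u - tr(u D_h² u) / d I)`. -/
def source (h : ℝ) (u : GridFun d J) : GridTensor d J := fun x =>
  (2 * P.B₀ * P.q ^ 2 / P.sPlus d) •
    (u x • hess h u x
      - ((u x • hess h u x).trace / (d : ℝ)) • (1 : Matrix (Fin d) (Fin d) ℝ))

/-- The variation `H_h` with respect to `Q`. -/
def varH (h : ℝ) (Q : GridTensor d J) (u : GridFun d J) : GridTensor d J := fun x =>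
  P.A • Q x
    - P.B • (Q x ^ 2 - ((Q x ^ 2).trace / (d : ℝ)) • (1 : Matrix (Fin d) (Fin d) ℝ))
    + (P.C * (Q x ^ 2).trace) • Q x
    + source P h u x
    + (2 * P.B₀ * P.q ^ 4 / P.sPlus d ^ 2 * u x ^ 2) • Q x

/-- The variation `μ_h` with respect to `u`. -/
def varMu (h : ℝ) (Q : GridTensor d J) (u : GridFun d J) : GridFun d J := fun x =>
  P.a * u x + P.b * u x ^ 2 + P.c * u x ^ 3
    + 2 * P.B₀ * P.q ^ 2 * (∑ k, ∑ l, tensorM P Q x k l * hess h u x k l)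
    + 2 * P.B₀ * P.q ^ 2 * divDiv h (fun y => u y • tensorM P Q y) x
    + 2 * P.B₀ * P.q ^ 4 * frob (tensorM P Q x) ^ 2 * u x

variable [NeZero J]

/-- The discrete nonlinear energy `E_{1h}`. -/
def energy1 (h : ℝ) (Q : GridTensor d J) (u : GridFun d J) : ℝ :=
  2 * P.B₀ * P.q ^ 2 * ipT h (hess h u) (fun x => u x • tensorM P Q x)
    + P.B₀ * P.q ^ 4 *
      ipT h (fun x => u x • tensorM P Q x) (fun x => u x • tensorM P Q x)
    + ip h (fun x => fbn P (Q x)) 1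
    + ip h (fun x => fs P (u x)) 1

/-- The factor `g = exp(s) / exp(E_{1h})`. -/
def gFac (h : ℝ) (Q : GridTensor d J) (u : GridFun d J) (s : ℝ) : ℝ :=
  Real.exp s / Real.exp (energy1 P h Q u)

/-- `ℒ_h = -K Δ_h + g κ₁ I` (on each entry of a matrix-valued grid function). -/
def opL (h κ₁ g : ℝ) : GridFun d J →L[ℝ] GridFun d J :=
  (-P.K) • LinearMap.toContinuousLinearMap (lapl h) + (g * κ₁) • 1

/-- `𝒟_h = 2 B₀ Δ_h² + g κ₂ I`. -/
def opD (h κ₂ g : ℝ) : GridFun d J →L[ℝ] GridFun d J :=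
  (2 * P.B₀) • LinearMap.toContinuousLinearMap (lapl h ∘ₗ lapl h) + (g * κ₂) • 1

/-- The dissipation rate
`ℛ = τ⁻¹ (⟨𝒬(τℒ)δQ, δQ⟩ + τ/2 ⟨ℒδQ, δQ⟩ + ⟨𝒬(τ𝒟)δu, δu⟩ + τ/2 ⟨𝒟δu, δu⟩)`. -/
def dissip (N : NumParams) (h g : ℝ) (δQ : GridTensor d J) (δu : GridFun d J) : ℝ :=
  let L : GridFun d J →L[ℝ] GridFun d J := opL P h N.κ₁ g
  let D : GridFun d J →L[ℝ] GridFun d J := opD P h N.κ₂ g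
  N.τ⁻¹ *
    (ipT h (entrywise (opQ (N.τ • L)) δQ) δQ + N.τ / 2 * ipT h (entrywise L δQ) δQ
      + ip h (opQ (N.τ • D) δu) δu + N.τ / 2 * ip h (D δu) δu)

/-! ### The scheme -/

/-- `(Q^n, u^n, s^n)` is generated by the first-order relaxed GSAV exponential integrator (ETD1)
scheme on the periodic grid of mesh size `len / J`, from symmetric traceless initial data and the
consistent initial auxiliary variable `s⁰ = E_{1h}⁰`. -/
structure IsNumSol (N : NumParams) (Q : ℕ → GridTensor d J) (u : ℕ → GridFun d J)
    (s : ℕ → ℝ) : Prop where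
  symm_init : ∀ x, (Q 0 x).IsSymm
  trace_init : ∀ x, (Q 0 x).trace = 0
  s_init : s 0 = energy1 P (N.len / J) (Q 0) (u 0)
  /-- `Q^{n+1} = e^{-τℒ} Q^n + τ φ₁(-τℒ) (g^n κ₁ Q^n - g^n H^n)` -/
  Q_step : ∀ n,
    let h := N.len / J
    let g := gFac P h (Q n) (u n) (s n)
    let T : GridFun d J →L[ℝ] GridFun d J := (-N.τ) • opL P h N.κ₁ g
    Q (n + 1) = entrywise (NormedSpace.exp T) (Q n)
      + N.τ • entrywise (phi1 T) ((g * N.κ₁) • Q n - g • varH P h (Q n) (u n))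
  /-- `u^{n+1} = e^{-τ𝒟} u^n + τ φ₁(-τ𝒟) (g^n κ₂ u^n - g^n μ^n)` -/
  u_step : ∀ n,
    let h := N.len / J
    let g := gFac P h (Q n) (u n) (s n)
    let T : GridFun d J →L[ℝ] GridFun d J := (-N.τ) • opD P h N.κ₂ g
    u (n + 1) = NormedSpace.exp T (u n)
      + N.τ • phi1 T ((g * N.κ₂) • u n - g • varMu P h (Q n) (u n))
  /-- provisional auxiliary variable `s̃^{n+1}`, followed by the relaxation with some feasible
  weight `ξ^{n+1}` -/
  s_step : ∀ n,
    let h := N.len / J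
    let g := gFac P h (Q n) (u n) (s n)
    let δQ := Q (n + 1) - Q n
    let δu := u (n + 1) - u n
    let sTilde := s n
      + g * (ipT h (varH P h (Q n) (u n)) δQ + ip h (varMu P h (Q n) (u n)) δu)
    ∃ ξ ∈ Set.Icc (0 : ℝ) 1,
      s (n + 1) = ξ * sTilde + (1 - ξ) * energy1 P h (Q (n + 1)) (u (n + 1)) ∧
      s (n + 1) - sTilde ≤ N.η₀ * N.τ * dissip P N h g δQ δu

/-! ### The quantities in the maximum bound principle -/

/-- `b₂ = 0`, `b₃ = |B| / √6`. -/
def bCoef (d : ℕ) (P : Params) : ℝ := if d = 3 then |P.B| / Real.sqrt 6 else 0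

/-- `f_d(ξ) = -A ξ + b_d ξ² - C ξ³ + S`. -/
def fd (d : ℕ) (P : Params) (S ξ : ℝ) : ℝ :=
  -P.A * ξ + bCoef d P * ξ ^ 2 - P.C * ξ ^ 3 + S

/-- The coefficient `Ã(x) = A + (2 B₀ q⁴ / s₊²) u(x)²`. -/
def Atilde (u : GridFun d J) (x : Grid d J) : ℝ :=
  P.A + 2 * P.B₀ * P.q ^ 4 / P.sPlus d ^ 2 * u x ^ 2

/-- `κ₀ = max { sup_x Ã(x) + C η², max_{ξ ∈ [0, η]} (A - 2 b_d ξ + 3 C ξ²) }`. -/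
def kappa0 (u : GridFun d J) (η : ℝ) : ℝ :=
  max ((⨆ x, Atilde P u x) + P.C * η ^ 2)
    (sSup ((fun ξ : ℝ => P.A - 2 * bCoef d P * ξ + 3 * P.C * ξ ^ 2) '' Set.Icc 0 η))

end Model

end SmA

end

namespace SmA

open Set MeasureTheory

section BanachAlgebra

variable {𝔸 : Type*} [NormedRing 𝔸] [NormedAlgebra ℝ 𝔸]

lemma norm_exp_le_exp_norm [NormOneClass 𝔸] (T : 𝔸) :
    ‖NormedSpace.exp T‖ ≤ Real.exp ‖T‖ := by
  rw [NormedSpace.exp_eq_tsum ℝ, Real.exp_eq_exp_ℝ, NormedSpace.exp_eq_tsum ℝ]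
  have h := NormedSpace.norm_expSeries_summable' (𝕂 := ℝ) T
  refine (norm_tsum_le_tsum_norm h).trans ?_
  refine h.tsum_le_tsum (fun k => ?_) (NormedSpace.expSeries_summable' (𝕂 := ℝ) ‖T‖)
  rw [norm_smul, smul_eq_mul]
  refine mul_le_mul (le_of_eq (by simp)) (norm_pow_le _ _) (norm_nonneg _) (by positivity)

variable [CompleteSpace 𝔸]

lemma summable_phi1 (T : 𝔸) :
    Summable fun k : ℕ => (((k + 1).factorial : ℝ)⁻¹) • T ^ k := by
  have h := NormedSpace.norm_expSeries_summable' (𝕂 := ℝ) T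
  refine Summable.of_norm (Summable.of_nonneg_of_le (fun _ => norm_nonneg _) (fun k => ?_) h)
  rw [norm_smul, norm_smul]
  gcongr
  · simp only [norm_inv, Real.norm_natCast]
    gcongr
    exact Nat.le_succ k

lemma phi1_eq_integral (T : 𝔸) : phi1 T = ∫ t in (0 : ℝ)..1, NormedSpace.exp (t • T) := by
  have key := intervalIntegral.hasSum_intervalIntegral_of_summable_norm (a := (0 : ℝ)) (b := 1)
    (f := fun k : ℕ =>
      (⟨fun t : ℝ => ((k.factorial : ℝ)⁻¹ * t ^ k) • T ^ k, by fun_prop⟩ : C(ℝ, 𝔸))) ?_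
  · have hterm : ∀ k : ℕ, ∫ t in (0 : ℝ)..1, ((k.factorial : ℝ)⁻¹ * t ^ k) • T ^ k
        = (((k + 1).factorial : ℝ)⁻¹) • T ^ k := fun k => by
      rw [intervalIntegral.integral_smul_const, intervalIntegral.integral_const_mul,
        integral_pow, Nat.factorial_succ]
      push_cast
      simp [mul_comm]
    simp only [ContinuousMap.coe_mk, hterm] at key
    rw [phi1, key.tsum_eq]
    refine intervalIntegral.integral_congr fun t _ => ?_
    simp only [NormedSpace.exp_eq_tsum ℝ, smul_pow, smul_smul]
  · refine Summable.of_nonneg_of_le (fun _ => norm_nonneg _) (fun k => ?_)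
      (NormedSpace.norm_expSeries_summable' (𝕂 := ℝ) T)
    rw [ContinuousMap.norm_le _ (norm_nonneg _)]
    rintro ⟨t, ht⟩
    replace ht : t ∈ Icc (0 : ℝ) 1 := by
      rwa [← uIcc_of_le (zero_le_one' ℝ)]
    simp only [ContinuousMap.restrict_apply, ContinuousMap.coe_mk]
    rw [norm_smul, norm_smul, norm_mul]
    refine mul_le_mul_of_nonneg_right (mul_le_of_le_one_right (norm_nonneg _) ?_) (norm_nonneg _)
    rw [norm_pow, Real.norm_of_nonneg ht.1]
    exact pow_le_one₀ ht.1 ht.2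

lemma norm_exp_sub_le [NormOneClass 𝔸] (P : 𝔸) (c : ℝ) :
    ‖NormedSpace.exp (P - c • (1 : 𝔸))‖ ≤ Real.exp (‖P‖ - c) := by
  let _ : NormedAlgebra ℚ 𝔸 := NormedAlgebra.restrictScalars ℚ ℝ 𝔸
  have hc : P - c • (1 : 𝔸) = P + algebraMap ℝ 𝔸 (-c) := by
    rw [Algebra.algebraMap_eq_smul_one, neg_smul, sub_eq_add_neg]
  rw [hc, NormedSpace.exp_add_of_commute (Algebra.commute_algebraMap_right _ _),
    ← NormedSpace.algebraMap_exp_comm, ← Real.exp_eq_exp_ℝ, sub_eq_add_neg, Real.exp_add]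
  refine (norm_mul_le _ _).trans ?_
  rw [norm_algebraMap', Real.norm_of_nonneg (Real.exp_pos _).le]
  gcongr
  exact norm_exp_le_exp_norm P

lemma norm_phi1_sub_le [NormOneClass 𝔸] (P : 𝔸) {p z : ℝ} (hP : ‖P‖ ≤ p) (hz : 0 < z) :
    ‖phi1 (P - (p + z) • (1 : 𝔸))‖ ≤ (1 - Real.exp (-z)) / z := by
  rw [phi1_eq_integral]
  have hint : ∫ t in (0 : ℝ)..1, Real.exp (-z * t) = (1 - Real.exp (-z)) / z := by
    rw [intervalIntegral.integral_comp_mul_left (f := Real.exp) (neg_ne_zero.mpr hz.ne'), integral_exp]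
    simp only [mul_one, mul_zero, Real.exp_zero, smul_eq_mul]
    field_simp
    ring
  rw [← hint]
  refine intervalIntegral.norm_integral_le_of_norm_le zero_le_one ?_
    (Continuous.intervalIntegrable (by fun_prop) _ _)
  refine Filter.Eventually.of_forall fun t ht => ?_
  have := norm_exp_sub_le (t • P) (t * (p + z))
  rw [smul_sub, smul_smul]
  refine this.trans (Real.exp_le_exp.mpr ?_)
  rw [norm_smul, Real.norm_of_nonneg ht.1.le]
  nlinarith [mul_le_mul_of_nonneg_left hP ht.1.le]

end BanachAlgebra

section Tensor

variable {d J : ℕ}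

/-- The entries of a matrix as a vector with the Euclidean norm. -/
def matVec : Matrix (Fin d) (Fin d) ℝ →ₗ[ℝ] EuclideanSpace ℝ (Fin d × Fin d) where
  toFun M := WithLp.toLp 2 fun p => M p.1 p.2
  map_add' _ _ := rfl
  map_smul' _ _ := rfl

lemma norm_matVec (M : Matrix (Fin d) (Fin d) ℝ) : ‖matVec M‖ = frob M := by
  rw [EuclideanSpace.norm_eq, frob, Fintype.sum_prod_type]
  simp only [Real.norm_eq_abs, sq_abs]
  rfl

lemma frob_nonneg (M : Matrix (Fin d) (Fin d) ℝ) : 0 ≤ frob M := Real.sqrt_nonneg _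

lemma frob_add_le (M N : Matrix (Fin d) (Fin d) ℝ) : frob (M + N) ≤ frob M + frob N := by
  simp only [← norm_matVec, map_add]
  exact norm_add_le _ _

lemma frob_sub_le (M N : Matrix (Fin d) (Fin d) ℝ) : frob (M - N) ≤ frob M + frob N := by
  simp only [← norm_matVec, map_sub]
  exact norm_sub_le _ _

lemma frob_smul (r : ℝ) (M : Matrix (Fin d) (Fin d) ℝ) : frob (r • M) = |r| * frob M := by
  simp only [← norm_matVec, map_smul, norm_smul, Real.norm_eq_abs]

lemma frob_sq (M : Matrix (Fin d) (Fin d) ℝ) : frob M ^ 2 = ∑ i, ∑ j, M i j ^ 2 :=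
  Real.sq_sqrt (Finset.sum_nonneg fun _ _ => Finset.sum_nonneg fun _ _ => sq_nonneg _)

lemma trace_sq_eq_frob_sq {M : Matrix (Fin d) (Fin d) ℝ} (hM : M.IsSymm) :
    (M ^ 2).trace = frob M ^ 2 := by
  rw [frob_sq, sq, Matrix.trace]
  refine Finset.sum_congr rfl fun i _ => ?_
  rw [Matrix.diag_apply, Matrix.mul_apply]
  exact Finset.sum_congr rfl fun j _ => by rw [hM.apply i j, sq]

/-- For symmetric traceless matrices of size two, the square is a multiple of the identity. -/
lemma sq_sub_trace_two {M : Matrix (Fin 2) (Fin 2) ℝ} (hM : M.IsSymm) (ht : M.trace = 0) :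
    M ^ 2 - ((M ^ 2).trace / (2 : ℝ)) • (1 : Matrix (Fin 2) (Fin 2) ℝ) = 0 := by
  have h10 : M 1 0 = M 0 1 := hM.apply 0 1
  have h11 : M 1 1 = -M 0 0 := by
    rw [Matrix.trace_fin_two] at ht
    linarith
  ext i j
  fin_cases i <;> fin_cases j <;>
    simp [sq, Matrix.trace_fin_two, Matrix.mul_apply, Fin.sum_univ_two, h10, h11] <;> ring

lemma frob_sq_sub_trace_three {M : Matrix (Fin 3) (Fin 3) ℝ} (hM : M.IsSymm)
    (ht : M.trace = 0) :
    frob (M ^ 2 - ((M ^ 2).trace / (3 : ℝ)) • (1 : Matrix (Fin 3) (Fin 3) ℝ))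
      = frob M ^ 2 / Real.sqrt 6 := by
  have h10 : M 1 0 = M 0 1 := hM.apply 0 1
  have h20 : M 2 0 = M 0 2 := hM.apply 0 2
  have h21 : M 2 1 = M 1 2 := hM.apply 1 2
  have h22 : M 2 2 = -M 0 0 - M 1 1 := by
    rw [Matrix.trace_fin_three] at ht
    linarith
  rw [← sq_eq_sq₀ (frob_nonneg _) (by positivity), div_pow, Real.sq_sqrt (by norm_num), frob_sq,
    frob_sq]
  simp [sq, Matrix.trace_fin_three, Matrix.mul_apply, Fin.sum_univ_three, Matrix.one_apply,
    h10, h20, h21, h22]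
  ring

/-- Matrix-valued grid functions with the maximum over the nodes of the Euclidean norm. -/
abbrev EucTensor (d J : ℕ) := Grid d J → EuclideanSpace ℝ (Fin d × Fin d)

/-- The identification of the matrix-valued grid functions with `EucTensor`. -/
def toEuc : GridTensor d J →ₗ[ℝ] EucTensor d J where
  toFun Φ := fun x => matVec (Φ x)
  map_add' _ _ := rfl
  map_smul' _ _ := rfl

/-- The sum of the translates by `± e_k`. -/
def nbrSum : GridFun d J →ₗ[ℝ] GridFun d J where
  toFun U := fun x => ∑ k : Fin d, (U (x + unitVec k) + U (x - unitVec k))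
  map_add' U V := by
    ext x
    simp only [Pi.add_apply, ← Finset.sum_add_distrib]
    exact Finset.sum_congr rfl fun _ _ => by ring
  map_smul' r U := by
    ext x
    simp only [Pi.smul_apply, smul_eq_mul, RingHom.id_apply, Finset.mul_sum, mul_add]

lemma lapl_eq (h : ℝ) :
    lapl (d := d) (J := J) h = (h ^ 2)⁻¹ • nbrSum - (2 * d * (h ^ 2)⁻¹) • LinearMap.id := by
  refine LinearMap.ext fun U => funext fun x => ?_
  simp only [lapl, LinearMap.coe_sum, Finset.sum_apply, LinearMap.comp_apply, fwdD, bwdD, nbrSum,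
    LinearMap.coe_mk, AddHom.coe_mk, LinearMap.sub_apply, LinearMap.smul_apply, LinearMap.id_apply,
    Pi.sub_apply, Pi.smul_apply, smul_eq_mul]
  rw [Finset.mul_sum]
  have : 2 * (d : ℝ) * (h ^ 2)⁻¹ * U x = ∑ _k : Fin d, 2 * (h ^ 2)⁻¹ * U x := by
    simp only [Finset.sum_const, Finset.card_univ, Fintype.card_fin, nsmul_eq_mul]
    ring
  rw [this, ← Finset.sum_sub_distrib]
  refine Finset.sum_congr rfl fun k _ => ?_
  rw [add_sub_cancel_right]
  ring

/-- Matrix-valued grid functions with symmetric traceless values. -/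
def IsQTensor (Φ : GridTensor d J) : Prop := ∀ x, (Φ x).IsSymm ∧ (Φ x).trace = 0

lemma IsQTensor.entrywise {Φ : GridTensor d J} (hΦ : IsQTensor Φ)
    (T : GridFun d J →L[ℝ] GridFun d J) : IsQTensor (entrywise T Φ) := by
  refine fun x => ⟨Matrix.IsSymm.ext fun i j => ?_, ?_⟩
  · simp only [SmA.entrywise, Matrix.of_apply]
    exact congrArg (fun U => T U x) (funext fun y => (hΦ y).1.apply i j)
  · have h0 : T (∑ i, fun y => Φ y i i) x = 0 := by
      have : (∑ i, fun y => Φ y i i) = (0 : GridFun d J) := by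
        ext y
        rw [Finset.sum_apply]
        exact (hΦ y).2
      rw [this, map_zero, Pi.zero_apply]
    rw [map_sum, Finset.sum_apply] at h0
    exact h0

lemma cenD_comm (h : ℝ) (k l : Fin d) (U : GridFun d J) :
    cenD h k (cenD h l U) = cenD h l (cenD h k U) := by
  ext x
  simp only [cenD, LinearMap.coe_mk, AddHom.coe_mk]
  rw [add_right_comm x, add_sub_right_comm x (unitVec k), sub_add_eq_add_sub x (unitVec k),
    sub_right_comm x]
  ring

lemma IsQTensor.add {Φ Ψ : GridTensor d J} (hΦ : IsQTensor Φ) (hΨ : IsQTensor Ψ) :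
    IsQTensor (Φ + Ψ) := fun x =>
  ⟨(hΦ x).1.add (hΨ x).1, by rw [Pi.add_apply, Matrix.trace_add, (hΦ x).2, (hΨ x).2, add_zero]⟩

lemma IsQTensor.smul {Φ : GridTensor d J} (hΦ : IsQTensor Φ) (r : ℝ) : IsQTensor (r • Φ) :=
  fun x => ⟨(hΦ x).1.smul r, by rw [Pi.smul_apply, Matrix.trace_smul, (hΦ x).2, smul_zero]⟩

lemma IsQTensor.sub {Φ Ψ : GridTensor d J} (hΦ : IsQTensor Φ) (hΨ : IsQTensor Ψ) :
    IsQTensor (Φ - Ψ) := fun x =>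
  ⟨(hΦ x).1.sub (hΨ x).1, by rw [Pi.sub_apply, Matrix.trace_sub, (hΦ x).2, (hΨ x).2, sub_zero]⟩

variable [NeZero J]

lemma frob_le_tensorSup (Φ : GridTensor d J) (x : Grid d J) : frob (Φ x) ≤ tensorSup Φ :=
  le_ciSup (f := fun x => frob (Φ x)) (Set.finite_range _).bddAbove x

lemma norm_toEuc (Φ : GridTensor d J) : ‖toEuc Φ‖ = tensorSup Φ := by
  have h0 : 0 ≤ tensorSup Φ := (frob_nonneg _).trans (frob_le_tensorSup Φ 0)
  refine le_antisymm ((pi_norm_le_iff_of_nonneg h0).mpr fun x => ?_) (ciSup_le fun x => ?_)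
  · exact (norm_matVec _).trans_le (frob_le_tensorSup Φ x)
  · exact (norm_matVec _).symm.trans_le (norm_le_pi_norm (toEuc Φ) x)

lemma tensorSup_add_le (Φ Ψ : GridTensor d J) :
    tensorSup (Φ + Ψ) ≤ tensorSup Φ + tensorSup Ψ := by
  simp only [← norm_toEuc, map_add]
  exact norm_add_le _ _

lemma tensorSup_smul {r : ℝ} (hr : 0 ≤ r) (Φ : GridTensor d J) :
    tensorSup (r • Φ) = r * tensorSup Φ := by
  simp only [← norm_toEuc, map_smul, norm_smul, Real.norm_of_nonneg hr]

/-- The entrywise action of the operators on scalar grid functions, as an algebra homomorphism. -/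
noncomputable def entrywiseHom :
    (GridFun d J →L[ℝ] GridFun d J) →ₐ[ℝ] (EucTensor d J →L[ℝ] EucTensor d J) :=
  AlgHom.ofLinearMap
    { toFun := fun T => LinearMap.toContinuousLinearMap
        { toFun := fun Φ x => WithLp.toLp 2 fun p => T (fun y => Φ y p) x
          map_add' := fun Φ Ψ => by
            ext x p
            exact congrFun (map_add T (fun y => Φ y p) (fun y => Ψ y p)) x
          map_smul' := fun r Φ => by
            ext x p
            exact congrFun (map_smul T r (fun y => Φ y p)) x }
      map_add' := fun _ _ => rfl
      map_smul' := fun _ _ => rfl } rfl (fun _ _ => rfl)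

lemma toEuc_entrywise (T : GridFun d J →L[ℝ] GridFun d J) (Φ : GridTensor d J) :
    toEuc (entrywise T Φ) = entrywiseHom T (toEuc Φ) := rfl

lemma continuous_entrywiseHom : Continuous (entrywiseHom (d := d) (J := J)) :=
  LinearMap.continuous_of_finiteDimensional (entrywiseHom (d := d) (J := J)).toLinearMap

lemma entrywiseHom_exp (T : GridFun d J →L[ℝ] GridFun d J) :
    entrywiseHom (NormedSpace.exp T) = NormedSpace.exp (entrywiseHom T) := by
  rw [NormedSpace.exp_eq_tsum ℝ, NormedSpace.exp_eq_tsum ℝ]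
  dsimp only
  rw [(NormedSpace.expSeries_summable' (𝕂 := ℝ) T).map_tsum _ continuous_entrywiseHom]
  simp only [map_smul, map_pow]

lemma entrywiseHom_phi1 (T : GridFun d J →L[ℝ] GridFun d J) :
    entrywiseHom (phi1 T) = phi1 (entrywiseHom T) := by
  rw [phi1, phi1, (summable_phi1 T).map_tsum _ continuous_entrywiseHom]
  simp only [map_smul, map_pow]

lemma norm_entrywiseHom_nbrSum_le :
    ‖entrywiseHom (LinearMap.toContinuousLinearMap (nbrSum (d := d) (J := J)))‖ ≤ 2 * d := by
  refine ContinuousLinearMap.opNorm_le_bound _ (by positivity) fun Φ => ?_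
  refine (pi_norm_le_iff_of_nonneg (by positivity)).mpr fun x => ?_
  have hx : entrywiseHom (LinearMap.toContinuousLinearMap nbrSum) Φ x
      = ∑ k : Fin d, (Φ (x + unitVec k) + Φ (x - unitVec k)) := by
    ext p
    rw [WithLp.ofLp_sum, Finset.sum_apply]
    rfl
  rw [hx]
  refine (norm_sum_le _ _).trans ?_
  refine (Finset.sum_le_card_nsmul _ _ (‖Φ‖ + ‖Φ‖) fun k _ => (norm_add_le _ _).trans
    (add_le_add (norm_le_pi_norm Φ _) (norm_le_pi_norm Φ _))).trans_eq ?_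
  simp only [Finset.card_univ, Fintype.card_fin, nsmul_eq_mul]
  ring

lemma smul_opL_eq (P : Params) (h κ g τ : ℝ) :
    (-τ) • (opL P h κ g : GridFun d J →L[ℝ] GridFun d J)
      = (τ * P.K * (h ^ 2)⁻¹) • LinearMap.toContinuousLinearMap nbrSum
        - (τ * P.K * (h ^ 2)⁻¹ * (2 * d) + τ * (g * κ)) • 1 := by
  rw [opL, lapl_eq]
  ext U x
  simp only [map_sub, map_smul, _root_.smul_apply, _root_.add_apply,
    _root_.sub_apply, LinearMap.coe_toContinuousLinearMap',
    one_apply_eq_self, LinearMap.id_apply, Pi.add_apply, Pi.sub_apply, Pi.smul_apply,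
    smul_eq_mul]
  ring

section Bounds

variable {P : Params} (h : ℝ) {κ g τ : ℝ}

lemma norm_scaled_nbrSum_le (hK : 0 < P.K) (hτ : 0 < τ) :
    ‖entrywiseHom ((τ * P.K * (h ^ 2)⁻¹) •
      LinearMap.toContinuousLinearMap (nbrSum (d := d) (J := J)))‖
      ≤ τ * P.K * (h ^ 2)⁻¹ * (2 * d) := by
  rw [map_smul, norm_smul, Real.norm_of_nonneg (by positivity)]
  exact mul_le_mul_of_nonneg_left norm_entrywiseHom_nbrSum_le (by positivity)

lemma tensorSup_exp_le [NeZero d] (hK : 0 < P.K) (hτ : 0 < τ) (Φ : GridTensor d J) :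
    tensorSup (entrywise (NormedSpace.exp
        ((-τ) • (opL P h κ g : GridFun d J →L[ℝ] GridFun d J))) Φ)
      ≤ Real.exp (-(τ * (g * κ))) * tensorSup Φ := by
  rw [← norm_toEuc, ← norm_toEuc Φ, toEuc_entrywise, entrywiseHom_exp, smul_opL_eq, map_sub,
    map_smul (entrywiseHom (d := d) (J := J)) _ 1, map_one]
  refine ContinuousLinearMap.le_of_opNorm_le _ ((norm_exp_sub_le _ _).trans ?_) _
  refine Real.exp_le_exp.mpr ?_
  linarith [norm_scaled_nbrSum_le (d := d) (J := J) h hK hτ]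

lemma tensorSup_phi1_le [NeZero d] (hK : 0 < P.K) (hτ : 0 < τ) (hgκ : 0 < g * κ)
    (Φ : GridTensor d J) :
    tensorSup (entrywise (phi1 ((-τ) • (opL P h κ g : GridFun d J →L[ℝ] GridFun d J))) Φ)
      ≤ (1 - Real.exp (-(τ * (g * κ)))) / (τ * (g * κ)) * tensorSup Φ := by
  rw [← norm_toEuc, ← norm_toEuc Φ, toEuc_entrywise, entrywiseHom_phi1, smul_opL_eq, map_sub,
    map_smul (entrywiseHom (d := d) (J := J)) _ 1, map_one]
  exact ContinuousLinearMap.le_of_opNorm_le _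
    (norm_phi1_sub_le _ (norm_scaled_nbrSum_le h hK hτ) (by positivity)) _

end Bounds

end Tensor

section MaximumBound

variable {d J : ℕ} {P : Params}

lemma frob_quadratic_le (hd : d = 2 ∨ d = 3) {M : Matrix (Fin d) (Fin d) ℝ} (hM : M.IsSymm)
    (ht : M.trace = 0) :
    frob (P.B • (M ^ 2 - ((M ^ 2).trace / (d : ℝ)) • (1 : Matrix (Fin d) (Fin d) ℝ)))
      ≤ bCoef d P * frob M ^ 2 := by
  rcases hd with rfl | rfl
  · rw [Nat.cast_ofNat, sq_sub_trace_two hM ht, smul_zero]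
    simp [frob, bCoef]
  · rw [Nat.cast_ofNat, frob_smul, frob_sq_sub_trace_three hM ht, bCoef, if_pos rfl]
    exact le_of_eq (by ring)

lemma trace_sub_trace_div_smul_one [NeZero d] (M : Matrix (Fin d) (Fin d) ℝ) :
    (M - (M.trace / (d : ℝ)) • (1 : Matrix (Fin d) (Fin d) ℝ)).trace = 0 := by
  have hd : (d : ℝ) ≠ 0 := Nat.cast_ne_zero.mpr (NeZero.ne d)
  rw [Matrix.trace_sub, Matrix.trace_smul, Matrix.trace_one, Fintype.card_fin, smul_eq_mul,
    div_mul_cancel₀ _ hd, sub_self]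

lemma isSymm_hess (h : ℝ) (u : GridFun d J) (x : Grid d J) : (hess h u x).IsSymm :=
  Matrix.IsSymm.ext fun k l => congrFun (cenD_comm h l k u) x

lemma IsQTensor.varH [NeZero d] {Q : GridTensor d J} (hQ : IsQTensor Q) (h : ℝ)
    (u : GridFun d J) : IsQTensor (varH P h Q u) := by
  refine fun x => ⟨?_, ?_⟩
  · have h1 : (1 : Matrix (Fin d) (Fin d) ℝ).IsSymm := Matrix.isSymm_one
    have hs := (hQ x).1
    exact ((((hs.smul _).sub (((hs.pow 2).sub (h1.smul _)).smul _)).add (hs.smul _)).add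
      ((((isSymm_hess h u x).smul _).sub (h1.smul _)).smul _)).add (hs.smul _)
  · have hquad := trace_sub_trace_div_smul_one (Q x ^ 2)
    have hsource := trace_sub_trace_div_smul_one (u x • hess h u x)
    rw [SmA.varH, source, Matrix.trace_add, Matrix.trace_add, Matrix.trace_add, Matrix.trace_sub]
    simp only [Matrix.trace_smul _ (Q x), Matrix.trace_smul P.B,
      Matrix.trace_smul (2 * P.B₀ * P.q ^ 2 / P.sPlus d), hquad, hsource, (hQ x).2, smul_zero,
      sub_zero, add_zero]

/-- Beyond some threshold the cubic `f_{d,S}` is nonpositive. -/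
lemma exists_forall_fd_nonpos (hC : 0 < P.C) (S : ℝ) :
    ∃ ηmin : ℝ, 0 < ηmin ∧ ∀ η : ℝ, ηmin ≤ η → fd d P S η ≤ 0 := by
  refine ⟨max 1 ((|P.A| + bCoef d P + |S|) / P.C), by positivity, fun η hη => ?_⟩
  obtain ⟨h1, h2⟩ := max_le_iff.mp hη
  rw [div_le_iff₀ hC] at h2
  have hη2 : η ≤ η ^ 2 := by nlinarith
  have hA : -P.A * η ≤ |P.A| * η ^ 2 :=
    (mul_le_mul_of_nonneg_right (neg_le_abs _) (by linarith)).trans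
      (mul_le_mul_of_nonneg_left hη2 (abs_nonneg _))
  have hS : S ≤ |S| * η ^ 2 :=
    (le_abs_self S).trans (le_mul_of_one_le_right (abs_nonneg _) (by linarith))
  have hc := mul_le_mul_of_nonneg_right h2 (sq_nonneg η)
  rw [fd]
  linarith

/-- The stabilized cubic is increasing on `[0, η]`. -/
lemma stabilized_fd_le {κ η r S : ℝ} (hr : r ∈ Icc 0 η)
    (hκ : ∀ ξ ∈ Icc 0 η, P.A - 2 * bCoef d P * ξ + 3 * P.C * ξ ^ 2 ≤ κ) :
    κ * r + fd d P S r ≤ κ * η + fd d P S η := by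
  have hderiv : ∀ ξ : ℝ, HasDerivAt (fun ξ => κ * ξ + fd d P S ξ)
      (κ - P.A + 2 * bCoef d P * ξ - 3 * P.C * ξ ^ 2) ξ := fun ξ => by
    refine (((hasDerivAt_id ξ).const_mul κ).add (((((hasDerivAt_id ξ).const_mul (-P.A)).add
      ((hasDerivAt_pow 2 ξ).const_mul (bCoef d P))).sub
        ((hasDerivAt_pow 3 ξ).const_mul P.C)).add_const S)).congr_deriv ?_
    push_cast
    ring
  refine monotoneOn_of_deriv_nonneg (convex_Icc 0 η)
    (fun ξ _ => (hderiv ξ).continuousAt.continuousWithinAt)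
    (fun ξ _ => (hderiv ξ).differentiableAt.differentiableWithinAt) (fun ξ hξ => ?_) hr
    (right_mem_Icc.mpr (hr.1.trans hr.2)) hr.2
  rw [(hderiv ξ).deriv]
  linarith [hκ ξ (interior_subset hξ)]

lemma le_kappa0_of_mem_Icc (u : GridFun d J) {η ξ : ℝ} (hξ : ξ ∈ Icc 0 η) :
    P.A - 2 * bCoef d P * ξ + 3 * P.C * ξ ^ 2 ≤ kappa0 P u η :=
  (le_csSup (isCompact_Icc.image (f := fun ξ : ℝ => P.A - 2 * bCoef d P * ξ + 3 * P.C * ξ ^ 2)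
    (by fun_prop)).bddAbove (mem_image_of_mem _ hξ)).trans (le_max_right _ _)

variable [NeZero J]

lemma Atilde_add_le_kappa0 (u : GridFun d J) (η : ℝ) (x : Grid d J) :
    Atilde P u x + P.C * η ^ 2 ≤ kappa0 P u η :=
  (add_le_add_left (le_ciSup (Set.finite_range _).bddAbove x) _).trans (le_max_left _ _)

/-- The stabilized nonlinearity maps the ball of radius `η` to the ball of radius `κ η`. -/
lemma tensorSup_stabilized_le (hd : d = 2 ∨ d = 3) (hC : 0 < P.C) (hB₀ : 0 < P.B₀) {h κ η : ℝ}
    {Q : GridTensor d J} {u : GridFun d J} (hQ : IsQTensor Q) (hκ : kappa0 P u η ≤ κ)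
    (hfd : fd d P (tensorSup (source P h u)) η ≤ 0) (hη : tensorSup Q ≤ η) :
    tensorSup (κ • Q - varH P h Q u) ≤ κ * η := by
  refine ciSup_le fun x => ?_
  have hr0 := frob_nonneg (Q x)
  have hrη : frob (Q x) ≤ η := (frob_le_tensorSup Q x).trans hη
  have hAt : P.A ≤ Atilde P u x := le_add_of_nonneg_right (by positivity)
  have hcoef : 0 ≤ κ - Atilde P u x - P.C * frob (Q x) ^ 2 := by
    have := mul_le_mul_of_nonneg_left (pow_le_pow_left₀ hr0 hrη 2) hC.le
    linarith [Atilde_add_le_kappa0 (P := P) u η x]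
  have hsplit : (κ • Q - varH P h Q u) x
      = (κ - Atilde P u x - P.C * frob (Q x) ^ 2) • Q x
        + P.B • (Q x ^ 2 - ((Q x ^ 2).trace / (d : ℝ)) • (1 : Matrix (Fin d) (Fin d) ℝ))
        - source P h u x := by
    rw [Pi.sub_apply, Pi.smul_apply, varH, Atilde, ← trace_sq_eq_frob_sq (hQ x).1]
    module
  rw [hsplit]
  refine (frob_sub_le _ _).trans ((add_le_add ((frob_add_le _ _).trans (add_le_add
    (frob_smul _ _).le (frob_quadratic_le hd (hQ x).1 (hQ x).2)))
    (frob_le_tensorSup (source P h u) x)).trans ?_)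
  rw [abs_of_nonneg hcoef]
  have hmono := stabilized_fd_le (S := tensorSup (source P h u)) ⟨hr0, hrη⟩
    fun ξ hξ => (le_kappa0_of_mem_Icc (P := P) u hξ).trans hκ
  have hA := mul_le_mul_of_nonneg_right hAt hr0
  rw [fd] at hmono
  linarith

end MaximumBound

section Scheme

variable {d J : ℕ} [NeZero J] {P : Params} {N : NumParams}
  {Q : ℕ → GridTensor d J} {u : ℕ → GridFun d J} {s : ℕ → ℝ}

lemma IsNumSol.gFac_zero (hsol : IsNumSol P N Q u s) :
    gFac P (N.len / J) (Q 0) (u 0) (s 0) = 1 := by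
  rw [gFac, hsol.s_init, div_self (Real.exp_ne_zero _)]

variable [NeZero d]

lemma IsNumSol.isQTensor (hsol : IsNumSol P N Q u s) (n : ℕ) : IsQTensor (Q n) := by
  induction n with
  | zero => exact fun x => ⟨hsol.symm_init x, hsol.trace_init x⟩
  | succ n ih =>
    rw [hsol.Q_step n]
    exact (ih.entrywise _).add (((((ih.smul _).sub ((ih.varH _ _).smul _))).entrywise _).smul _)

/-- One step of the scheme preserves the bound. -/
lemma IsNumSol.tensorSup_succ_le (hsol : IsNumSol P N Q u s) (hd : d = 2 ∨ d = 3)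
    (hK : 0 < P.K) (hC : 0 < P.C) (hB₀ : 0 < P.B₀) (hτ : 0 < N.τ) (hκ₁ : 0 < N.κ₁) {η : ℝ}
    {n : ℕ} (hfd : fd d P (tensorSup (source P (N.len / J) (u n))) η ≤ 0)
    (hκ : kappa0 P (u n) η ≤ N.κ₁) (hη : tensorSup (Q n) ≤ η) :
    tensorSup (Q (n + 1)) ≤ η := by
  set g := gFac P (N.len / J) (Q n) (u n) (s n) with hg
  have hgpos : 0 < g := div_pos (Real.exp_pos _) (Real.exp_pos _)
  have hgκ : 0 < g * N.κ₁ := mul_pos hgpos hκ₁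
  have hstep := hsol.Q_step n
  simp only [← hg] at hstep
  have hfac : (g * N.κ₁) • Q n - g • varH P (N.len / J) (Q n) (u n)
      = g • (N.κ₁ • Q n - varH P (N.len / J) (Q n) (u n)) := by module
  have hnl := tensorSup_stabilized_le hd hC hB₀ (hsol.isQTensor n) hκ hfd hη
  have hexp : 0 ≤ 1 - Real.exp (-(N.τ * (g * N.κ₁))) :=
    sub_nonneg.mpr (Real.exp_le_one_iff.mpr (by nlinarith [mul_pos hτ hgκ]))
  rw [hstep, hfac]
  refine (tensorSup_add_le _ _).trans ((add_le_add (tensorSup_exp_le _ hK hτ _)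
    ((tensorSup_smul hτ.le _).le.trans (mul_le_mul_of_nonneg_left
      ((tensorSup_phi1_le _ hK hτ hgκ _).trans (mul_le_mul_of_nonneg_left
        ((tensorSup_smul hgpos.le _).le.trans (mul_le_mul_of_nonneg_left hnl hgpos.le))
        (by positivity))) hτ.le))).trans ?_)
  refine (add_le_add_left (mul_le_mul_of_nonneg_left hη (Real.exp_pos _).le) _).trans_eq ?_
  field_simp
  ring

end Scheme

end SmA

theorem theorem11 (d : ℕ) (P : SmA.Params)
    (hK : 0 < P.K) (hC : 0 < P.C) (hB₀ : 0 < P.B₀)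
    (hd : (d = 2 ∧ P.A < 0) ∨ (d = 3 ∧ 0 < P.B ∧ P.A < P.B ^ 2 / (27 * P.C))) :
    -- `η` "sufficiently large": for any source bound `S`, all large `η` satisfy `f_d(η) ≤ 0`
    (∀ S : ℝ, ∃ ηmin : ℝ, 0 < ηmin ∧ ∀ η : ℝ, ηmin ≤ η → SmA.fd d P S η ≤ 0) ∧
    -- the maximum bound principle, up to any finite or infinite number `M` of time steps
    (∀ (J : ℕ) [NeZero J] (N : SmA.NumParams),
      0 < N.len → 0 < N.τ → 0 < N.κ₁ → 0 < N.κ₂ → N.η₀ ∈ Set.Icc (0 : ℝ) 1 →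
      ∀ (Q : ℕ → SmA.GridTensor d J) (u : ℕ → SmA.GridFun d J) (s : ℕ → ℝ),
      SmA.IsNumSol P N Q u s →
      ∀ (M : ℕ∞) (η Gstar : ℝ), 0 < η →
      (∀ n : ℕ, (n : ℕ∞) < M →
        SmA.fd d P (SmA.tensorSup (SmA.source P (N.len / J) (u n))) η ≤ 0) →
      0 < Gstar →
      (∀ n : ℕ, (n : ℕ∞) < M →
        Gstar ≤ SmA.gFac P (N.len / J) (Q n) (u n) (s n)) →
      (∀ n : ℕ, (n : ℕ∞) < M → N.κ₁ ≥ 1 / Gstar * SmA.kappa0 P (u n) η) →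
      SmA.tensorSup (Q 0) ≤ η →
      ∀ n : ℕ, (n : ℕ∞) ≤ M → SmA.tensorSup (Q n) ≤ η) := by
  refine ⟨SmA.exists_forall_fd_nonpos hC, ?_⟩
  intro J _ N _ hτ hκ₁ _ _ Q u s hsol M η Gstar _ hfd hG hgle hκ h0 n
  have hd' : d = 2 ∨ d = 3 := hd.imp And.left And.left
  have : NeZero d := ⟨by omega⟩
  induction n with
  | zero => exact fun _ => h0
  | succ n ih =>
    intro hn
    have hnM : (n : ℕ∞) < M := (ENat.natCast_lt_natCast.mpr n.lt_succ_self).trans_le hn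
    have hG1 : Gstar ≤ 1 := by
      rw [← hsol.gFac_zero]
      exact hgle 0 ((ENat.natCast_le_natCast.mpr n.zero_le).trans_lt hnM)
    refine hsol.tensorSup_succ_le hd' hK hC hB₀ hτ hκ₁ (hfd n hnM) ?_ (ih hnM.le)
    rcases le_or_gt (SmA.kappa0 P (u n) η) 0 with hneg | hpos
    · exact hneg.trans hκ₁.le
    · exact (le_mul_of_one_le_left hpos.le ((one_le_div hG).mpr hG1)).trans (hκ n hnM)
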